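/- There are $n$ voters and a set $\mathcal C=\{c_1,\dots,c_m\}$ of $m$ candidates; voter $v$ ranks the candidates by a bijection $r_v:\mathcal C\to\{1,\dots,m\}$ (rank $1$ is best). For a committee $T\subseteq\mathcal C$ with $|T|\ge s$ let $$r_{\mathcal V}(T)=\frac1n\sum_{v}\ \min_{Q\subseteq T,\ |Q|=s}\ \sum_{c\in Q}r_v(c)$$ be its $s$-Borda score, and let $\mathrm{Opt}=\min_{T\subseteq\mathcal C,\,|T|=k}r_{\mathcal V}(T)$. Consider the following randomized algorithm for choosing a committee of size $k$. 1. Solve the linear program: minimize $\sum_{i=1}^n\sum_{\ell=1}^s\sum_{j=1}^m x_{ij}^{\ell}\, r_{v_i}(c_j)$ subject to $\sum_j y_j=k$; $\ \sum_{\ell=1}^k x_{ij}^{\ell}\le y_j$ for all $i,j$; $\ \sum_j x_{ij}^{\ell}\ge 1$ for all $i$ and all $\ell\in\{1,\dots,k\}$; $\ y_j,x_{ij}^{\ell}\in[0,1]$. Let $\tilde y$ be the $y$-part of an optimal solution. 2. Let $y_j=(1-\frac1{\sqrt s})\,\tilde y_j$. 3. Apply dependent rounding to $y$: while two coordinates $y_i,y_j$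 ($i\ne j$) lie strictly between $0$ and $1$, pick such a pair (arbitrarily, possibly depending on the history), let $\alpha=\min(1-y_i,y_j)$ and $\beta=\min(y_i,1-y_j)$, and replace $(y_i,y_j)$ by $(y_i+\alpha,y_j-\alpha)$ with probability $\frac{\beta}{\alpha+\beta}$ and by $(y_i-\beta,y_j+\beta)$ with probability $\frac{\alpha}{\alpha+\beta}$; if a single fractional coordinate $y_i$ remains, round it to $1$ with probability $y_i$ and to $0$ otherwise. Let $T_1$ be the set of candidates whose coordinate ends at $1$; thus $|T_1|$ is $k(1-\frac1{\sqrt s})$ rounded up or down, and exactly this number when it is an integer. 4. Choose $T_2$ uniformly at random among the sets of $k-|T_1|$ candidates in $\mathcal C\setminus T_1$ (so $|T_2|=k/\sqrt s$ when this is an integer), and output $T=T_1\cup T_2$. **Theorem.** When $m=\omega(k)$, $k=\omega(s^{3/2})$ and $s=\omega(1)$, the algorithm can always be carried out, it always outputs a committee $T$ of size $k$, and $$\mathbb E[r_{\mathcal V}(T)]\ \le\ 3\,\mathrm{Opt}+O(s^{3/2}\log s)\cdot\frac{m+1}{k+1}.$$ That is, there are absolute constants $A,N>0$ such that for all $n$,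 all $s,k,m$ with $k\le m$, $s\ge N$, $k\ge N s^{3/2}$, $m\ge N k$, and all preference profiles, some execution of the algorithm exists, and every execution (whatever optimal LP solution and whatever pairs are picked) outputs a committee of size $k$ and satisfies $\mathbb E[r_{\mathcal V}(T)]\le 3\,\mathrm{Opt}+A\,s^{3/2}\log s\cdot\frac{m+1}{k+1}$. -/

import Mathlib

/-! Elections with `n` voters and `m` candidates, the `s`-Borda score, its LP relaxation,
dependent rounding, and the LP-rounding algorithm. -/

namespace SBorda

noncomputable section

/-- A preference profile: voter `v` ranks the candidates bijectively; `r v c` is the zero-based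
position of candidate `c` in the order of `v` (position `0` is the top). -/
abbrev Profile (n m : ℕ) : Type := Fin n → (Fin m ≃ Fin m)

/-- The rank `r_v(c) ∈ {1, …, m}`. -/
def rank {n m : ℕ} (r : Profile n m) (v : Fin n) (c : Fin m) : ℕ := (r v c : ℕ) + 1

/-- The cost of the committee `T` for voter `v`: the minimum over all `Q ⊆ T` with `|Q| = s` of
`∑_{c ∈ Q} r_v(c)`. It is a minimum over a finite set, which is non-empty as soon as `s ≤ |T|`. -/
def voterCost {n m : ℕ} (r : Profile n m) (s : ℕ) (v : Fin n) (T : Finset (Fin m)) : ℝ :=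
  ⨅ Q : {Q : Finset (Fin m) // Q ⊆ T ∧ Q.card = s}, ∑ c ∈ Q.1, (rank r v c : ℝ)

/-- The `s`-Borda score of the committee `T`: the average cost over all voters. -/
def score {n m : ℕ} (r : Profile n m) (s : ℕ) (T : Finset (Fin m)) : ℝ :=
  (1 / (n : ℝ)) * ∑ v, voterCost r s v T

/-- The minimum `s`-Borda score of a committee of size `k` (the minimum is over a finite set,
non-empty as soon as `k ≤ m`). -/
def opt {n m : ℕ} (r : Profile n m) (k s : ℕ) : ℝ :=
  ⨅ T : {T : Finset (Fin m) // T.card = k}, score r s T.1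

/-! ### The linear program -/

/-- Feasibility for the LP relaxation. `y j` is the extent to which candidate `j` is chosen and
`x i j l` the extent to which the `l`-th copy of voter `i` is assigned to candidate `j`. -/
structure LPFeasible {n m : ℕ} (k : ℕ) (y : Fin m → ℝ) (x : Fin n → Fin m → Fin k → ℝ) :
    Prop where
  sum_y : ∑ j, y j = k
  sum_x_le : ∀ i j, ∑ l, x i j l ≤ y j
  one_le_sum_x : ∀ i l, 1 ≤ ∑ j, x i j l
  y_mem : ∀ j, y j ∈ Set.Icc (0 : ℝ) 1
  x_mem : ∀ i j l, x i j l ∈ Set.Icc (0 : ℝ) 1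

/-- The objective `∑_i ∑_{l ≤ s} ∑_j x_{ij}^l r_{v_i}(c_j)`; only the first `s` of the `k` copies
of a voter are charged. -/
def lpObjective {n m : ℕ} (r : Profile n m) (k s : ℕ) (x : Fin n → Fin m → Fin k → ℝ) : ℝ :=
  ∑ i, ∑ l ∈ Finset.univ.filter (fun l : Fin k => (l : ℕ) < s), ∑ j, x i j l * (rank r i j : ℝ)

/-- `y` is the candidate part of an optimal solution of the LP. -/
def IsLPOptimal {n m : ℕ} (r : Profile n m) (k s : ℕ) (y : Fin m → ℝ) : Prop :=
  ∃ x : Fin n → Fin m → Fin k → ℝ, LPFeasible k y x ∧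
    ∀ (y' : Fin m → ℝ) (x' : Fin n → Fin m → Fin k → ℝ), LPFeasible k y' x' →
      lpObjective r k s x ≤ lpObjective r k s x'

/-! ### Dependent rounding -/

/-- `μ` is the law of: with probability `p` sample from `μ₁`, otherwise sample from `μ₂`. -/
def IsMixture {X : Type*} (p : ℝ) (μ₁ μ₂ μ : PMF X) : Prop :=
  ∀ a, (μ a).toReal = p * (μ₁ a).toReal + (1 - p) * (μ₂ a).toReal

/-- The vector obtained from `y` by adding `t` to coordinate `i` and subtracting it from `j`. -/
def shift {C : Type*} [DecidableEq C] (y : C → ℝ) (i j : C) (t : ℝ) : C → ℝ :=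
  Function.update (Function.update y i (y i + t)) j (y j - t)

/-- `DependentRounding y μ`: `μ` is the law of the random set produced by an execution of
dependent rounding on the vector `y`.

* If every coordinate is `0` or `1`, the procedure stops and outputs the coordinates equal to `1`.
* If two coordinates `i ≠ j` are fractional, pick such a pair (in any way depending on the current
  vector and the history). With `α = min (1 - y i) (y j)` and `β = min (y i) (1 - y j)`, replace
  `(y i, y j)` by `(y i + α, y j - α)` with probability `β / (α + β)` and by `(y i - β, y j + β)`
  with probability `α / (α + β)`, and continue.
* If exactly one coordinate `i` is fractional (possible only when `∑ j, y j` is not an integer),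
  round it to `1` with probability `y i` and to `0` with probability `1 - y i`. -/
inductive DependentRounding {C : Type*} [Fintype C] [DecidableEq C] :
    (C → ℝ) → PMF (Finset C) → Prop
  | done (y : C → ℝ) (T : Finset C) (hT : ∀ c, (c ∈ T ∧ y c = 1) ∨ (c ∉ T ∧ y c = 0)) :
      DependentRounding y (PMF.pure T)
  | pair (y : C → ℝ) (i j : C) (hij : i ≠ j)
      (hi : y i ∈ Set.Ioo (0 : ℝ) 1) (hj : y j ∈ Set.Ioo (0 : ℝ) 1) (α β : ℝ)
      (hα : α = min (1 - y i) (y j)) (hβ : β = min (y i) (1 - y j))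
      (μ₁ μ₂ μ : PMF (Finset C))
      (h₁ : DependentRounding (shift y i j α) μ₁)
      (h₂ : DependentRounding (shift y i j (-β)) μ₂)
      (hμ : IsMixture (β / (α + β)) μ₁ μ₂ μ) :
      DependentRounding y μ
  | last (y : C → ℝ) (i : C) (hi : y i ∈ Set.Ioo (0 : ℝ) 1)
      (hrest : ∀ j, j ≠ i → y j = 0 ∨ y j = 1)
      (μ₁ μ₂ μ : PMF (Finset C))
      (h₁ : DependentRounding (Function.update y i 1) μ₁)
      (h₂ : DependentRounding (Function.update y i 0) μ₂)
      (hμ : IsMixture (y i) μ₁ μ₂ μ) :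
      DependentRounding y μ

/-! ### The algorithm -/

theorem completions_nonempty {m k : ℕ} (hkm : k ≤ m) (T₁ : Finset (Fin m)) :
    ((T₁ᶜ).powersetCard (k - T₁.card)).Nonempty := by
  apply Finset.powersetCard_nonempty.2
  rw [Finset.card_compl, Fintype.card_fin]
  omega

/-- Complete `T₁` to a committee of size `k` by adding a uniformly random set of `k - |T₁|`
candidates outside `T₁`. -/
def completeUniformly {m k : ℕ} (hkm : k ≤ m) (T₁ : Finset (Fin m)) : PMF (Finset (Fin m)) :=
  (PMF.uniformOfFinset ((T₁ᶜ).powersetCard (k - T₁.card)) (completions_nonempty hkm T₁)).map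
    fun T₂ => T₁ ∪ T₂

/-- `μ` is the law of the committee output by an execution of the algorithm: take an optimal LP
solution `y`, scale it by `1 - 1 / √s`, apply dependent rounding to get `T₁`, and add uniformly
random candidates outside `T₁` up to size `k`. When `k / √s` is an integer, the scaled solution has
integral sum, `|T₁| = k (1 - 1 / √s)` and exactly `k / √s` random candidates are added. -/
def IsOutputLaw {n m k : ℕ} (r : Profile n m) (s : ℕ) (hkm : k ≤ m)
    (μ : PMF (Finset (Fin m))) : Prop :=
  ∃ (y : Fin m → ℝ) (ν : PMF (Finset (Fin m))),
    IsLPOptimal r k s y ∧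
    DependentRounding (fun j => (1 - 1 / √(s : ℝ)) * y j) ν ∧
    μ = ν.bind (completeUniformly hkm)

/-- The expected `s`-Borda score of a random committee with law `μ`. -/
def expectedScore {n m : ℕ} (r : Profile n m) (s : ℕ) (μ : PMF (Finset (Fin m))) : ℝ :=
  ∑ T, (μ T).toReal * score r s T

end

end SBorda

/-!
Write `N_t` for the number of committee members and `F_t` for the LP mass among the first `t`
candidates of a fixed voter. Summing ranks by layers, the cost of the voter is at most
`∑_t (s - N_t)⁺`, while the LP pays at least `∑_t (s - F_t)⁺` for that voter, so it suffices to
compare the two sums layer by layer.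

Both dependent rounding and uniform completion avoid a set of candidates with probability at most
the product of the one-candidate bounds. Expanding `exp (-a N_t)` over avoided sets therefore gives
`E[exp (-a N_t)] ≤ (1 - b q) ^ t * exp (-a (1 - a)² F_t)` with `a = 1 / √s`, `b = 1 - exp (-a)` and
`q = a k / (2 m)`, where the first factor comes from the random completion. If
`F_t ≤ (1 - a) s`, the LP shortfall `s - F_t` is at least `√s`, which dominates both the loss due to
scaling and the deviation of `N_t`; this costs the factor `3`. Otherwise the expected shortfall is
at most `9 √s (1 - b q) ^ t`, and summing this geometric series over `t` gives `O(s^{3/2} m / k)`.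
-/

namespace SBorda

/-! ### Finitely supported expectations -/

section Mean

/-- The expectation `E[f]` under a probability mass function on a finite type, as the finite sum
that `expectedScore` uses. -/
noncomputable def mean {X : Type*} [Fintype X] (μ : PMF X) (f : X → ℝ) : ℝ :=
  ∑ a, (μ a).toReal * f a

theorem IsMixture.mem_support {X : Type*} {p : ℝ} {μ₁ μ₂ μ : PMF X} (h : IsMixture p μ₁ μ₂ μ)
    {a : X} (ha : a ∈ μ.support) : a ∈ μ₁.support ∨ a ∈ μ₂.support := by
  by_contra! hn
  have hμa := h a
  rw [(μ₁.apply_eq_zero_iff a).2 hn.1, (μ₂.apply_eq_zero_iff a).2 hn.2, ENNReal.toReal_zero,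
    mul_zero, mul_zero, add_zero, ENNReal.toReal_eq_zero_iff] at hμa
  exact hμa.elim ((μ.mem_support_iff a).1 ha) (μ.apply_ne_top a)

theorem exists_isMixture {X : Type*} {p : ℝ} (hp : p ∈ Set.Icc (0 : ℝ) 1) (μ₁ μ₂ : PMF X) :
    ∃ μ, IsMixture p μ₁ μ₂ μ := by
  have hp1 : 0 ≤ 1 - p := sub_nonneg.2 hp.2
  have hadd : ENNReal.ofReal p + ENNReal.ofReal (1 - p) = 1 := by
    rw [← ENNReal.ofReal_add hp.1 hp1, add_sub_cancel, ENNReal.ofReal_one]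
  refine ⟨⟨fun a => ENNReal.ofReal p * μ₁ a + ENNReal.ofReal (1 - p) * μ₂ a, ?_⟩, fun a => ?_⟩
  · rw [ENNReal.summable.hasSum_iff, ENNReal.tsum_add, ENNReal.tsum_mul_left,
      ENNReal.tsum_mul_left, μ₁.tsum_coe, μ₂.tsum_coe, mul_one, mul_one, hadd]
  · have h₁ := ENNReal.mul_ne_top (ENNReal.ofReal_ne_top (r := p)) (μ₁.apply_ne_top a)
    have h₂ := ENNReal.mul_ne_top (ENNReal.ofReal_ne_top (r := 1 - p)) (μ₂.apply_ne_top a)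
    change (ENNReal.ofReal p * μ₁ a + ENNReal.ofReal (1 - p) * μ₂ a).toReal = _
    rw [ENNReal.toReal_add h₁ h₂, ENNReal.toReal_mul, ENNReal.toReal_mul,
      ENNReal.toReal_ofReal hp.1, ENNReal.toReal_ofReal hp1]

variable {X Y : Type*} [Fintype X] [Fintype Y]

theorem sum_toReal_apply (μ : PMF X) : ∑ a, (μ a).toReal = 1 := by
  rw [← ENNReal.toReal_sum fun a _ => μ.apply_ne_top a, ← tsum_fintype (L := .unconditional _),
    μ.tsum_coe, ENNReal.toReal_one]

theorem mean_mono {μ : PMF X} {f g : X → ℝ} (h : ∀ a ∈ μ.support, f a ≤ g a) :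
    mean μ f ≤ mean μ g := by
  refine Finset.sum_le_sum fun a _ => ?_
  by_cases ha : a ∈ μ.support
  · exact mul_le_mul_of_nonneg_left (h a ha) ENNReal.toReal_nonneg
  · rw [(μ.apply_eq_zero_iff a).2 ha, ENNReal.toReal_zero, zero_mul, zero_mul]

theorem mean_const (μ : PMF X) (c : ℝ) : mean μ (fun _ => c) = c := by
  rw [mean, ← Finset.sum_mul, sum_toReal_apply, one_mul]

theorem mean_add (μ : PMF X) (f g : X → ℝ) :
    mean μ (fun a => f a + g a) = mean μ f + mean μ g := by
  simp only [mean, mul_add, Finset.sum_add_distrib]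

theorem mean_const_mul (μ : PMF X) (c : ℝ) (f : X → ℝ) :
    mean μ (fun a => c * f a) = c * mean μ f := by
  simp only [mean, Finset.mul_sum, mul_left_comm]

theorem mean_sum {ι : Type*} (μ : PMF X) (s : Finset ι) (f : ι → X → ℝ) :
    mean μ (fun a => ∑ i ∈ s, f i a) = ∑ i ∈ s, mean μ (f i) := by
  simp only [mean, Finset.mul_sum]
  exact Finset.sum_comm

theorem mean_pure (a : X) (f : X → ℝ) : mean (PMF.pure a) f = f a := by
  classical
  rw [mean, Finset.sum_eq_single a] <;> simp +contextual [PMF.pure_apply]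

theorem mean_bind (ν : PMF X) (κ : X → PMF Y) (f : Y → ℝ) :
    mean (ν.bind κ) f = mean ν fun a => mean (κ a) f := by
  have hbind (b : Y) : ((ν.bind κ) b).toReal = ∑ a, (ν a).toReal * (κ a b).toReal := by
    rw [PMF.bind_apply, tsum_fintype, ENNReal.toReal_sum fun a _ =>
      ENNReal.mul_ne_top (ν.apply_ne_top a) ((κ a).apply_ne_top b)]
    simp only [ENNReal.toReal_mul]
  simp only [mean, hbind, Finset.sum_mul, Finset.mul_sum, mul_assoc]
  exact Finset.sum_comm

theorem mean_map (μ : PMF X) (g : X → Y) (f : Y → ℝ) :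
    mean (μ.map g) f = mean μ fun a => f (g a) := by
  simp only [PMF.map, mean_bind, Function.comp_apply, mean_pure]

theorem mean_uniformOfFinset (s : Finset X) (hs : s.Nonempty) (f : X → ℝ) :
    mean (PMF.uniformOfFinset s hs) f = (∑ a ∈ s, f a) / s.card := by
  classical
  simp only [mean, PMF.uniformOfFinset_apply, apply_ite ENNReal.toReal, ENNReal.toReal_inv,
    ENNReal.toReal_natCast, ENNReal.toReal_zero, ite_mul, zero_mul, Finset.sum_ite_mem,
    Finset.univ_inter]
  rw [← Finset.mul_sum, inv_mul_eq_div]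

theorem IsMixture.mean_eq {p : ℝ} {μ₁ μ₂ μ : PMF X} (h : IsMixture p μ₁ μ₂ μ) (f : X → ℝ) :
    mean μ f = p * mean μ₁ f + (1 - p) * mean μ₂ f := by
  simp only [mean, h _, Finset.mul_sum, ← Finset.sum_add_distrib, add_mul, mul_assoc]

end Mean

/-! ### Dependent rounding -/

section Rounding

variable {C : Type*} [DecidableEq C]

theorem shift_apply_left {y : C → ℝ} {i j : C} (hij : i ≠ j) (t : ℝ) :
    shift y i j t i = y i + t := by
  rw [shift, Function.update_of_ne hij, Function.update_self]

theorem shift_apply_right (y : C → ℝ) (i j : C) (t : ℝ) : shift y i j t j = y j - t :=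
  Function.update_self _ _ _

theorem shift_apply_of_ne {y : C → ℝ} {i j c : C} (hi : c ≠ i) (hj : c ≠ j) (t : ℝ) :
    shift y i j t c = y c := by
  rw [shift, Function.update_of_ne hj, Function.update_of_ne hi]

theorem shift_mem_Icc {y : C → ℝ} {i j : C} (hij : i ≠ j) (hy : ∀ c, y c ∈ Set.Icc (0 : ℝ) 1)
    {t : ℝ} (hi₀ : -y i ≤ t) (hi₁ : t ≤ 1 - y i) (hj₀ : t ≤ y j) (hj₁ : y j - 1 ≤ t) (c : C) :
    shift y i j t c ∈ Set.Icc (0 : ℝ) 1 := by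
  by_cases hi : c = i
  · subst hi
    rw [shift_apply_left hij]
    constructor <;> linarith
  by_cases hj : c = j
  · subst hj
    rw [shift_apply_right]
    constructor <;> linarith
  rw [shift_apply_of_ne hi hj]
  exact hy c

theorem shift_up_mem_Icc {y : C → ℝ} {i j : C} (hij : i ≠ j)
    (hy : ∀ c, y c ∈ Set.Icc (0 : ℝ) 1) (c : C) :
    shift y i j (min (1 - y i) (y j)) c ∈ Set.Icc (0 : ℝ) 1 := by
  have h₀ : 0 ≤ min (1 - y i) (y j) := le_min (sub_nonneg.2 (hy i).2) (hy j).1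
  exact shift_mem_Icc hij hy (by linarith [(hy i).1]) (min_le_left _ _) (min_le_right _ _)
    (by linarith [(hy j).2]) c

theorem shift_down_mem_Icc {y : C → ℝ} {i j : C} (hij : i ≠ j)
    (hy : ∀ c, y c ∈ Set.Icc (0 : ℝ) 1) (c : C) :
    shift y i j (-min (y i) (1 - y j)) c ∈ Set.Icc (0 : ℝ) 1 := by
  have h₀ : 0 ≤ min (y i) (1 - y j) := le_min (hy i).1 (sub_nonneg.2 (hy j).2)
  exact shift_mem_Icc hij hy (neg_le_neg (min_le_left _ _)) (by linarith [(hy i).2])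
    (by linarith [(hy j).1]) (by linarith [min_le_right (y i) (1 - y j)]) c

theorem update_mem_Icc {y : C → ℝ} (hy : ∀ c, y c ∈ Set.Icc (0 : ℝ) 1) (i : C) {t : ℝ}
    (ht : t ∈ Set.Icc (0 : ℝ) 1) (c : C) : Function.update y i t c ∈ Set.Icc (0 : ℝ) 1 := by
  rcases eq_or_ne c i with rfl | hc
  · rwa [Function.update_self]
  · rw [Function.update_of_ne hc]
    exact hy c

theorem update_eq_zero_or_one {y : C → ℝ} {i : C} (hy : ∀ j, j ≠ i → y j = 0 ∨ y j = 1) {t : ℝ}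
    (ht : t = 0 ∨ t = 1) (c : C) : Function.update y i t c = 0 ∨ Function.update y i t c = 1 := by
  rcases eq_or_ne c i with rfl | hc
  · rwa [Function.update_self]
  · rw [Function.update_of_ne hc]
    exact hy c hc

theorem prod_ite_mem_eq_ite_disjoint (R T : Finset C) :
    (∏ c ∈ R, if c ∈ T then (0 : ℝ) else 1) = if Disjoint R T then 1 else 0 := by
  simp only [Finset.disjoint_left, ← ite_not (_ ∈ T), Finset.prod_ite_zero, Finset.prod_const_one]

variable [Fintype C]

theorem sum_update (y : C → ℝ) (i : C) (t : ℝ) :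
    ∑ c, Function.update y i t c = ∑ c, y c + (t - y i) := by
  rw [Finset.sum_update_of_mem (Finset.mem_univ i), Finset.sdiff_singleton_eq_erase,
    ← Finset.add_sum_erase _ y (Finset.mem_univ i)]
  ring

theorem sum_shift (y : C → ℝ) {i j : C} (hij : i ≠ j) (t : ℝ) :
    ∑ c, shift y i j t c = ∑ c, y c := by
  rw [shift, sum_update, sum_update, Function.update_of_ne hij.symm]
  ring

theorem prod_update (φ : C → ℝ → ℝ) (y : C → ℝ) (i : C) (t : ℝ) :
    ∏ c, φ c (Function.update y i t c) = φ i t * ∏ c ∈ Finset.univ.erase i, φ c (y c) := by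
  simp only [Function.apply_update, Finset.prod_update_of_mem (Finset.mem_univ i),
    Finset.sdiff_singleton_eq_erase]

theorem prod_shift (φ : C → ℝ → ℝ) (y : C → ℝ) {i j : C} (hij : i ≠ j) (t : ℝ) :
    ∏ c, φ c (shift y i j t c) =
      φ i (y i + t) * φ j (y j - t) * ∏ c ∈ (Finset.univ.erase j).erase i, φ c (y c) := by
  have hi : i ∈ Finset.univ.erase j := Finset.mem_erase.2 ⟨hij, Finset.mem_univ i⟩
  rw [shift, prod_update]
  simp only [Function.apply_update]
  rw [Finset.prod_update_of_mem hi, Finset.sdiff_singleton_eq_erase]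
  ring

theorem prod_shift_mixture_le {w y : C → ℝ} {i j : C} (hij : i ≠ j) (hw : ∀ c, 0 ≤ w c)
    (hwy : ∀ c, 0 ≤ 1 - w c * y c) {α β : ℝ} (hα : 0 < α) (hβ : 0 < β) :
    β / (α + β) * ∏ c, (1 - w c * shift y i j α c) +
      (1 - β / (α + β)) * ∏ c, (1 - w c * shift y i j (-β) c) ≤ ∏ c, (1 - w c * y c) := by
  have hy : ∏ c, (1 - w c * y c) = ∏ c, (1 - w c * shift y i j 0 c) := by simp [shift]
  simp only [hy, prod_shift (fun c t => 1 - w c * t) y hij]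
  have hR : 0 ≤ ∏ c ∈ (Finset.univ.erase j).erase i, (1 - w c * y c) :=
    Finset.prod_nonneg fun c _ => hwy c
  generalize ∏ c ∈ (Finset.univ.erase j).erase i, (1 - w c * y c) = R at hR
  have hgap : 0 ≤ w i * w j * (α * β) * R := by have := hw i; have := hw j; positivity
  rw [← sub_nonneg]
  convert hgap using 1
  field_simp
  ring

theorem DependentRounding.mean_prod_le {y : C → ℝ} {μ : PMF (Finset C)}
    (h : DependentRounding y μ) (hy : ∀ c, y c ∈ Set.Icc (0 : ℝ) 1) {w : C → ℝ}
    (hw : ∀ c, w c ∈ Set.Icc (0 : ℝ) 1) :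
    mean μ (fun T => ∏ c, if c ∈ T then 1 - w c else 1) ≤ ∏ c, (1 - w c * y c) := by
  have hwy {z : C → ℝ} (hz : ∀ c, z c ∈ Set.Icc (0 : ℝ) 1) (c : C) : 0 ≤ 1 - w c * z c :=
    sub_nonneg.2 (mul_le_one₀ (hw c).2 (hz c).1 (hz c).2)
  induction h with
  | done y T hT =>
    rw [mean_pure]
    refine (Finset.prod_congr rfl fun c _ => ?_).le
    rcases hT c with ⟨hc, hyc⟩ | ⟨hc, hyc⟩ <;> simp [hc, hyc]
  | pair y i j hij hi hj α β hα hβ μ₁ μ₂ μ _ _ hμ ih₁ ih₂ =>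
    have hα0 : 0 < α := hα ▸ lt_min (sub_pos.2 hi.2) hj.1
    have hβ0 : 0 < β := hβ ▸ lt_min hi.1 (sub_pos.2 hj.2)
    have hp : β / (α + β) ≤ 1 := (div_le_one (by positivity)).2 (by linarith)
    rw [hμ.mean_eq]
    refine le_trans (add_le_add ?_ ?_)
      (prod_shift_mixture_le hij (fun c => (hw c).1) (hwy hy) hα0 hβ0)
    · exact mul_le_mul_of_nonneg_left (ih₁ (hα ▸ shift_up_mem_Icc hij hy)) (by positivity)
    · exact mul_le_mul_of_nonneg_left (ih₂ (hβ ▸ shift_down_mem_Icc hij hy)) (sub_nonneg.2 hp)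
  | last y i hi _ μ₁ μ₂ μ _ _ hμ ih₁ ih₂ =>
    have h₁ := ih₁ (update_mem_Icc hy i ⟨zero_le_one, le_rfl⟩)
    have h₂ := ih₂ (update_mem_Icc hy i ⟨le_rfl, zero_le_one⟩)
    have hprod := prod_update fun c t => 1 - w c * t
    have hy_prod := hprod y i (y i)
    rw [Function.update_eq_self] at hy_prod
    rw [hprod] at h₁ h₂
    rw [hμ.mean_eq, hy_prod]
    calc _ ≤ _ := add_le_add (mul_le_mul_of_nonneg_left h₁ hi.1.le)
          (mul_le_mul_of_nonneg_left h₂ (sub_nonneg.2 hi.2.le))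
      _ = _ := by ring

/-- The one-sided negative correlation that both rounding and uniform sampling satisfy: the random
set with law `μ` misses any given set with probability at most the product of the bounds `p c` on
the probabilities of missing its elements. -/
def AvoidanceLE (μ : PMF (Finset C)) (p : C → ℝ) : Prop :=
  ∀ R : Finset C, mean μ (fun T => if Disjoint R T then 1 else 0) ≤ ∏ c ∈ R, p c

theorem DependentRounding.avoidanceLE {y : C → ℝ} {μ : PMF (Finset C)}
    (h : DependentRounding y μ) (hy : ∀ c, y c ∈ Set.Icc (0 : ℝ) 1) :
    AvoidanceLE μ fun c => 1 - y c := by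
  intro R
  let w : C → ℝ := fun c => if c ∈ R then 1 else 0
  have hw (c : C) : w c ∈ Set.Icc (0 : ℝ) 1 := by
    by_cases hc : c ∈ R <;> simp [w, hc]
  have hprod (f : C → ℝ) : ∏ c, (1 - w c * f c) = ∏ c ∈ R, (1 - f c) := by
    rw [← Finset.univ_inter R, ← Finset.prod_ite_mem]
    refine Finset.prod_congr rfl fun c _ => ?_
    by_cases hR : c ∈ R <;> simp [w, hR]
  have hmiss (T : Finset C) :
      (∏ c, if c ∈ T then 1 - w c else 1) = if Disjoint R T then 1 else 0 := by
    rw [← prod_ite_mem_eq_ite_disjoint, ← Finset.univ_inter R, ← Finset.prod_ite_mem]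
    refine Finset.prod_congr rfl fun c _ => ?_
    by_cases hR : c ∈ R <;> simp [w, hR]
  simpa only [hmiss, hprod] using h.mean_prod_le hy hw

theorem DependentRounding.card_le_ceil {y : C → ℝ} {μ : PMF (Finset C)}
    (h : DependentRounding y μ) : ∀ T ∈ μ.support, (T.card : ℤ) ≤ ⌈∑ c, y c⌉ := by
  have hsum {z : C → ℝ} {T : Finset C} (hT : ∀ c, (c ∈ T ∧ z c = 1) ∨ (c ∉ T ∧ z c = 0)) :
      ∑ c, z c = (T.card : ℤ) := by
    have hz (c : C) : z c = if c ∈ T then 1 else 0 := by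
      rcases hT c with ⟨hc, hzc⟩ | ⟨hc, hzc⟩ <;> simp [hc, hzc]
    simp only [hz, Finset.sum_boole, Finset.filter_univ_mem, Int.cast_natCast]
  induction h with
  | done y T hT =>
    intro U hU
    rw [PMF.support_pure, Set.mem_singleton_iff] at hU
    rw [hU, hsum hT, Int.ceil_intCast]
  | pair y i j hij _ _ α β _ _ μ₁ μ₂ μ _ _ hμ ih₁ ih₂ =>
    intro T hT
    rw [sum_shift y hij] at ih₁ ih₂
    exact (hμ.mem_support hT).elim (ih₁ T) (ih₂ T)
  | last y i hi hrest μ₁ μ₂ μ _ _ hμ ih₁ ih₂ =>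
    intro T hT
    have hupdate (t : ℝ) : ∑ c, Function.update y i t c = ∑ c, y c + (t - y i) := sum_update y i t
    rcases hμ.mem_support hT with hT | hT
    · refine (ih₁ T hT).trans ?_
      -- The rounded-up vector is integral, so its sum is an integer below `∑ y + 1`.
      have hint : ∑ c, Function.update y i 1 c =
          ((Finset.univ.filter fun c => Function.update y i 1 c = 1).card : ℤ) := by
        refine hsum fun c => ?_
        rcases update_eq_zero_or_one hrest (.inr rfl) c with hc | hc <;> simp [hc]
      rw [hint, Int.ceil_intCast, ← Int.sub_one_lt_iff, Int.lt_ceil, Int.cast_sub, ← hint, hupdate,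
        Int.cast_one]
      linarith [hi.1]
    · refine (ih₂ T hT).trans (Int.ceil_mono ?_)
      rw [hupdate]
      linarith [hi.1]

theorem DependentRounding.card_add_floor_le {y : C → ℝ} {μ : PMF (Finset C)}
    (h : DependentRounding y μ) {k : ℕ} {x : ℝ} (hx : 0 ≤ x) (hy : ∑ c, y c = k - x)
    {T : Finset C} (hT : T ∈ μ.support) : T.card + ⌊x⌋₊ ≤ k := by
  have hcard := h.card_le_ceil T hT
  rw [hy, sub_eq_add_neg, Int.ceil_natCast_add, Int.ceil_neg] at hcard
  have hfloor := Int.natCast_floor_eq_floor hx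
  omega

/-- The coordinates on which dependent rounding still has to act. -/
noncomputable def fractional (y : C → ℝ) : Finset C :=
  Finset.univ.filter fun c => y c ∈ Set.Ioo (0 : ℝ) 1

omit [DecidableEq C] in
theorem mem_fractional {y : C → ℝ} {c : C} : c ∈ fractional y ↔ y c ∈ Set.Ioo (0 : ℝ) 1 := by
  simp only [fractional, Finset.mem_filter, Finset.mem_univ, true_and]

theorem card_fractional_shift_lt {y : C → ℝ} {i j : C} (hij : i ≠ j)
    (hi : y i ∈ Set.Ioo (0 : ℝ) 1) (hj : y j ∈ Set.Ioo (0 : ℝ) 1) {t : ℝ}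
    (ht : y i + t ∉ Set.Ioo (0 : ℝ) 1 ∨ y j - t ∉ Set.Ioo (0 : ℝ) 1) :
    (fractional (shift y i j t)).card < (fractional y).card := by
  refine Finset.card_lt_card ⟨fun c hc => ?_, fun hsup => ?_⟩
  · rw [mem_fractional] at hc ⊢
    by_cases hci : c = i
    · exact hci ▸ hi
    by_cases hcj : c = j
    · exact hcj ▸ hj
    rwa [shift_apply_of_ne hci hcj] at hc
  · have hi' := mem_fractional.1 (hsup (mem_fractional.2 hi))
    have hj' := mem_fractional.1 (hsup (mem_fractional.2 hj))
    rw [shift_apply_left hij] at hi'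
    rw [shift_apply_right] at hj'
    exact ht.elim (· hi') (· hj')

theorem exists_dependentRounding_of_forall_eq {y : C → ℝ} (hy : ∀ c, y c = 0 ∨ y c = 1) :
    ∃ μ, DependentRounding y μ := by
  refine ⟨_, .done y (Finset.univ.filter fun c => y c = 1) fun c => ?_⟩
  rcases hy c with h | h <;> simp [h]

theorem exists_dependentRounding_of_forall_ne {y : C → ℝ} {i : C} (hi : y i ∈ Set.Ioo (0 : ℝ) 1)
    (hy : ∀ j, j ≠ i → y j = 0 ∨ y j = 1) : ∃ μ, DependentRounding y μ := by
  obtain ⟨μ₁, h₁⟩ :=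
    exists_dependentRounding_of_forall_eq (update_eq_zero_or_one hy (t := 1) (.inr rfl))
  obtain ⟨μ₂, h₂⟩ :=
    exists_dependentRounding_of_forall_eq (update_eq_zero_or_one hy (t := 0) (.inl rfl))
  obtain ⟨μ, hμ⟩ := exists_isMixture (Set.Ioo_subset_Icc_self hi) μ₁ μ₂
  exact ⟨μ, .last y i hi hy μ₁ μ₂ μ h₁ h₂ hμ⟩

theorem exists_dependentRounding (y : C → ℝ) (hy : ∀ c, y c ∈ Set.Icc (0 : ℝ) 1) :
    ∃ μ, DependentRounding y μ := by
  induction hN : (fractional y).card using Nat.strong_induction_on generalizing y with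
  | _ N ih =>
  have hint {c : C} (hc : y c ∉ Set.Ioo (0 : ℝ) 1) : y c = 0 ∨ y c = 1 := by
    by_contra! hne
    exact hc ⟨(hy c).1.lt_of_ne hne.1.symm, (hy c).2.lt_of_ne hne.2⟩
  by_cases hfrac : ∃ i, y i ∈ Set.Ioo (0 : ℝ) 1
  swap
  · exact exists_dependentRounding_of_forall_eq fun c => hint fun hc => hfrac ⟨c, hc⟩
  obtain ⟨i, hi⟩ := hfrac
  by_cases hpair : ∃ j, j ≠ i ∧ y j ∈ Set.Ioo (0 : ℝ) 1
  swap
  · exact exists_dependentRounding_of_forall_ne hi fun j hj => hint fun hc => hpair ⟨j, hj, hc⟩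
  obtain ⟨j, hji, hj⟩ := hpair
  have hij := hji.symm
  have hα : 0 < min (1 - y i) (y j) := lt_min (sub_pos.2 hi.2) hj.1
  have hβ : 0 < min (y i) (1 - y j) := lt_min hi.1 (sub_pos.2 hj.2)
  obtain ⟨μ₁, h₁⟩ := ih _ (hN ▸ card_fractional_shift_lt hij hi hj (by
    rcases min_choice (1 - y i) (y j) with h | h <;> simp [h])) _ (shift_up_mem_Icc hij hy) rfl
  obtain ⟨μ₂, h₂⟩ := ih _ (hN ▸ card_fractional_shift_lt hij hi hj (by
    rcases min_choice (y i) (1 - y j) with h | h <;> simp [h])) _ (shift_down_mem_Icc hij hy) rfl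
  obtain ⟨μ, hμ⟩ := exists_isMixture (p := min (y i) (1 - y j) /
    (min (1 - y i) (y j) + min (y i) (1 - y j)))
    ⟨by positivity, (div_le_one (by positivity)).2 (by linarith)⟩ μ₁ μ₂
  exact ⟨μ, .pair y i j hij hi hj _ _ rfl rfl μ₁ μ₂ μ h₁ h₂ hμ⟩

end Rounding

/-! ### Uniform completion -/

section Completion

theorem cast_choose_eq_choose_succ_mul {n K : ℕ} (hK : K ≤ n + 1) :
    (n.choose K : ℝ) = (n + 1).choose K * (1 - (K : ℝ) / (n + 1)) := by
  have h := congrArg (Nat.cast (R := ℝ)) (Nat.choose_mul_succ_eq n K)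
  push_cast [Nat.cast_sub hK] at h
  field_simp
  linarith

theorem cast_choose_sub_le {M K : ℕ} (hK : K ≤ M) {j : ℕ} (hj : j ≤ M) :
    ((M - j).choose K : ℝ) ≤ M.choose K * (1 - (K : ℝ) / M) ^ j := by
  have hq : 0 ≤ 1 - (K : ℝ) / M :=
    sub_nonneg.2 (div_le_one_of_le₀ (Nat.cast_le.2 hK) (Nat.cast_nonneg M))
  induction j with
  | zero => simp
  | succ j ih =>
    obtain ⟨n, hn⟩ : ∃ n, M - j = n + 1 := ⟨M - j - 1, by omega⟩
    have hnM : (n : ℝ) + 1 ≤ M := by exact_mod_cast (by omega : n + 1 ≤ M)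
    specialize ih (by omega)
    rw [hn] at ih
    rw [show M - (j + 1) = n by omega, pow_succ, ← mul_assoc]
    refine le_trans ?_ (mul_le_mul_of_nonneg_right ih hq)
    rcases le_or_gt K (n + 1) with hKn | hKn
    · rw [cast_choose_eq_choose_succ_mul hKn]
      gcongr
    · rw [Nat.choose_eq_zero_of_lt (by omega), Nat.cast_zero]
      positivity

theorem card_filter_disjoint_powersetCard {C : Type*} [DecidableEq C] {U R : Finset C} (hR : R ⊆ U)
    (K : ℕ) : ((U.powersetCard K).filter (Disjoint R)).card = (U.card - R.card).choose K := by
  rw [← Finset.card_sdiff_of_subset hR, ← Finset.card_powersetCard]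
  congr 1
  ext A
  simp only [Finset.mem_filter, Finset.mem_powersetCard, Finset.subset_sdiff, disjoint_comm]
  tauto

variable {m k : ℕ}

theorem card_of_mem_support_completeUniformly (hkm : k ≤ m) {T₁ T : Finset (Fin m)}
    (hT₁ : T₁.card ≤ k) (hT : T ∈ (completeUniformly hkm T₁).support) : T.card = k := by
  rw [completeUniformly, PMF.mem_support_map_iff] at hT
  obtain ⟨A, hA, rfl⟩ := hT
  rw [PMF.mem_support_uniformOfFinset_iff, Finset.mem_powersetCard] at hA
  have hdisj : Disjoint T₁ A := disjoint_compl_right.mono_right hA.1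
  rw [Finset.card_union_of_disjoint hdisj, hA.2, Nat.add_sub_cancel' hT₁]

theorem mean_completeUniformly_disjoint_le (hkm : k ≤ m) (T₁ R : Finset (Fin m)) {q : ℝ}
    (hq : q ≤ ((k - T₁.card : ℕ) : ℝ) / ((m - T₁.card : ℕ) : ℝ)) :
    mean (completeUniformly hkm T₁) (fun T => if Disjoint R T then 1 else 0) ≤
      (if Disjoint R T₁ then 1 else 0) * (1 - q) ^ R.card := by
  simp only [completeUniformly, mean_map, mean_uniformOfFinset, Finset.disjoint_union_right]
  by_cases hR : Disjoint R T₁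
  swap
  · simp [hR]
  have hcard : T₁ᶜ.card = m - T₁.card := by rw [Finset.card_compl, Fintype.card_fin]
  have hRU : R ⊆ T₁ᶜ := fun c hc => Finset.mem_compl.2 (Finset.disjoint_left.1 hR hc)
  have hKU : k - T₁.card ≤ T₁ᶜ.card := by omega
  have hle := cast_choose_sub_le hKU (Finset.card_le_card hRU)
  simp only [hR, true_and, if_true, one_mul, Finset.sum_boole, Finset.card_powersetCard,
    card_filter_disjoint_powersetCard hRU]
  rw [div_le_iff₀' (by exact_mod_cast Nat.choose_pos hKU)]
  refine hle.trans ?_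
  rw [hcard] at hKU ⊢
  have hrate : ((k - T₁.card : ℕ) : ℝ) / ((m - T₁.card : ℕ) : ℝ) ≤ 1 :=
    div_le_one_of_le₀ (Nat.cast_le.2 hKU) (Nat.cast_nonneg _)
  gcongr

theorem AvoidanceLE.bind_completeUniformly {ν : PMF (Finset (Fin m))} {p : Fin m → ℝ}
    (hν : AvoidanceLE ν p) (hkm : k ≤ m) {q : ℝ} (hq₁ : q ≤ 1)
    (hq : ∀ T₁ ∈ ν.support, q ≤ ((k - T₁.card : ℕ) : ℝ) / ((m - T₁.card : ℕ) : ℝ)) :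
    AvoidanceLE (ν.bind (completeUniformly hkm)) fun c => (1 - q) * p c := by
  intro R
  rw [mean_bind, Finset.prod_mul_distrib, Finset.prod_const]
  calc _ ≤ mean ν fun T₁ => (1 - q) ^ R.card * if Disjoint R T₁ then 1 else 0 :=
        mean_mono fun T₁ hT₁ =>
          (mean_completeUniformly_disjoint_le hkm T₁ R (hq T₁ hT₁)).trans_eq (mul_comm _ _)
    _ ≤ _ := by
      rw [mean_const_mul]
      exact mul_le_mul_of_nonneg_left (hν R) (pow_nonneg (sub_nonneg.2 hq₁) _)

theorem div_two_mul_le_completion_rate {x : ℝ} (hx : 1 ≤ x) (hkm : k ≤ m) {t : ℕ}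
    (ht : t + ⌊x⌋₊ ≤ k) : x / (2 * m) ≤ ((k - t : ℕ) : ℝ) / ((m - t : ℕ) : ℝ) := by
  have hfloor : 1 ≤ ⌊x⌋₊ := Nat.one_le_floor_iff x |>.2 hx
  have hk : (⌊x⌋₊ : ℝ) ≤ (k - t : ℕ) := by exact_mod_cast (by omega : ⌊x⌋₊ ≤ k - t)
  have hm : ((m - t : ℕ) : ℝ) ≤ m := by exact_mod_cast Nat.sub_le m t
  have hm₀ : (0 : ℝ) < (m - t : ℕ) := by exact_mod_cast (by omega : 0 < m - t)
  rw [← div_div]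
  have hhalf := Nat.div_two_lt_floor hx
  gcongr
  linarith

end Completion

/-! ### Exponential moments -/

section ExpMoment

open Real

variable {C : Type*} [DecidableEq C] [Fintype C] {μ : PMF (Finset C)}

theorem AvoidanceLE.mean_prod_le {p : C → ℝ} (h : AvoidanceLE μ p) (S : Finset C) {u : C → ℝ}
    (hu : ∀ c, u c ∈ Set.Icc (0 : ℝ) 1) :
    mean μ (fun T => ∏ c ∈ S, if c ∈ T then u c else 1) ≤ ∏ c ∈ S, ((1 - u c) * p c + u c) := by
  have hexpand (T : Finset C) : (∏ c ∈ S, if c ∈ T then u c else 1) =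
      ∑ R ∈ S.powerset, ((∏ c ∈ R, (1 - u c)) * ∏ c ∈ S \ R, u c) *
        if Disjoint R T then 1 else 0 := by
    calc _ = ∏ c ∈ S, ((1 - u c) * (if c ∈ T then 0 else 1) + u c) :=
          Finset.prod_congr rfl fun c _ => by split_ifs <;> ring
      _ = _ := by
        simp only [Finset.prod_add, Finset.prod_mul_distrib, prod_ite_mem_eq_ite_disjoint,
          mul_right_comm]
  simp only [hexpand, mean_sum, mean_const_mul, Finset.prod_add, Finset.prod_mul_distrib]
  refine Finset.sum_le_sum fun R _ => ?_
  rw [mul_right_comm _ _ (∏ c ∈ S \ R, u c)]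
  exact mul_le_mul_of_nonneg_left (h R) <| mul_nonneg
    (Finset.prod_nonneg fun c _ => sub_nonneg.2 (hu c).2) (Finset.prod_nonneg fun c _ => (hu c).1)

theorem AvoidanceLE.mean_exp_neg_card_le {y : C → ℝ} {q : ℝ}
    (h : AvoidanceLE μ fun c => (1 - q) * (1 - y c)) (hy : ∀ c, y c ∈ Set.Icc (0 : ℝ) 1)
    (hq : q ∈ Set.Icc (0 : ℝ) 1) {a : ℝ} (ha : 0 ≤ a) (S : Finset C) :
    mean μ (fun T => exp (-(a * (S ∩ T).card))) ≤
      (1 - (1 - exp (-a)) * q) ^ S.card * exp (-((1 - exp (-a)) * (1 - q) * ∑ c ∈ S, y c)) := by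
  have hu : exp (-a) ∈ Set.Icc (0 : ℝ) 1 := ⟨(exp_pos _).le, exp_le_one_iff.2 (neg_nonpos.2 ha)⟩
  have hcard (T : Finset C) :
      exp (-(a * (S ∩ T).card)) = ∏ c ∈ S, if c ∈ T then exp (-a) else 1 := by
    rw [Finset.prod_ite_mem, Finset.prod_const, ← exp_nat_mul]
    ring_nf
  simp only [hcard]
  refine (h.mean_prod_le S fun _ => hu).trans ?_
  generalize exp (-a) = u at hu
  have hu₁ := sub_nonneg.2 hu.2
  have hq₁ := sub_nonneg.2 hq.2
  have hbq : (1 - u) * q ≤ 1 := mul_le_one₀ (by linarith [hu.1]) hq.1 hq.2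
  rw [Finset.mul_sum, ← Finset.sum_neg_distrib, exp_sum, ← Finset.prod_const,
    ← Finset.prod_mul_distrib]
  refine Finset.prod_le_prod (fun c _ => ?_) fun c _ => ?_
  · exact add_nonneg (mul_nonneg hu₁ (mul_nonneg hq₁ (sub_nonneg.2 (hy c).2))) hu.1
  · have hnonneg : 0 ≤ (1 - u) * q * ((1 - u) * (1 - q) * y c) :=
      mul_nonneg (mul_nonneg hu₁ hq.1) (mul_nonneg (mul_nonneg hu₁ hq₁) (hy c).1)
    calc (1 - u) * ((1 - q) * (1 - y c)) + u
        ≤ (1 - (1 - u) * q) * (1 - (1 - u) * (1 - q) * y c) := by linarith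
      _ ≤ _ := mul_le_mul_of_nonneg_left (one_sub_le_exp_neg _) (sub_nonneg.2 hbq)

end ExpMoment

/-! ### Layer-cake bounds for voter costs and the linear program -/

section Cost

variable {n m k s : ℕ}

/-- The candidates that voter `v` ranks among the first `t`. -/
def topSet (r : Profile n m) (v : Fin n) (t : ℕ) : Finset (Fin m) :=
  Finset.univ.filter fun c => (r v c : ℕ) < t

theorem mem_topSet {r : Profile n m} {v : Fin n} {t : ℕ} {c : Fin m} :
    c ∈ topSet r v t ↔ rank r v c ≤ t := by
  simp only [topSet, rank, Finset.mem_filter, Finset.mem_univ, true_and, Nat.succ_le_iff]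

theorem card_topSet (r : Profile n m) (v : Fin n) {t : ℕ} (ht : t ≤ m) :
    (topSet r v t).card = t := by
  have hmap : topSet r v t =
      (Finset.univ.filter fun c : Fin m => (c : ℕ) < t).map (r v).symm.toEmbedding := by
    ext c
    simp [topSet, Finset.mem_map_equiv]
  rw [hmap, Finset.card_map, Fin.card_filter_val_lt, min_eq_right ht]

theorem rank_eq_sum (r : Profile n m) (v : Fin n) (c : Fin m) :
    (rank r v c : ℝ) = ∑ t ∈ Finset.range m, if c ∈ topSet r v t then 0 else 1 := by
  have hfilter : (Finset.range m).filter (fun t => c ∉ topSet r v t) =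
      Finset.range (rank r v c) := by
    ext t
    have hlt := (r v c).isLt
    simp only [mem_topSet, rank, Finset.mem_filter, Finset.mem_range]
    omega
  simp only [← ite_not (_ ∈ _), Finset.sum_boole, hfilter, Finset.card_range]

theorem sum_mul_rank_eq_sum_sub (r : Profile n m) (v : Fin n) (z : Fin m → ℝ) :
    ∑ j, z j * (rank r v j : ℝ) =
      ∑ t ∈ Finset.range m, (∑ j, z j - ∑ j ∈ topSet r v t, z j) := by
  simp only [rank_eq_sum, Finset.mul_sum]
  rw [Finset.sum_comm]
  refine Finset.sum_congr rfl fun t _ => ?_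
  rw [← Finset.sum_compl_add_sum (topSet r v t) z, add_sub_cancel_right,
    ← Finset.univ_inter (topSet r v t)ᶜ, ← Finset.sum_ite_mem]
  simp only [Finset.mem_compl, ite_not, mul_ite, mul_zero, mul_one]

theorem sum_rank_eq_sum_sub_card (r : Profile n m) (v : Fin n) (Q : Finset (Fin m)) :
    ∑ c ∈ Q, (rank r v c : ℝ) =
      ∑ t ∈ Finset.range m, ((Q.card : ℝ) - (topSet r v t ∩ Q).card) := by
  simpa [Finset.sum_ite_mem] using sum_mul_rank_eq_sum_sub r v fun j => if j ∈ Q then 1 else 0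

theorem exists_voterCost_eq (r : Profile n m) (v : Fin n) {T : Finset (Fin m)}
    (hs : s ≤ T.card) : ∃ Q ⊆ T, Q.card = s ∧ voterCost r s v T = ∑ c ∈ Q, (rank r v c : ℝ) := by
  obtain ⟨Q₀, hQ₀, hc₀⟩ := Finset.exists_subset_card_eq hs
  have : Nonempty {Q : Finset (Fin m) // Q ⊆ T ∧ Q.card = s} := ⟨⟨Q₀, hQ₀, hc₀⟩⟩
  obtain ⟨Q, hQ⟩ := exists_eq_ciInf_of_finite
    (f := fun Q : {Q : Finset (Fin m) // Q ⊆ T ∧ Q.card = s} => ∑ c ∈ Q.1, (rank r v c : ℝ))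
  exact ⟨Q.1, Q.2.1, Q.2.2, hQ.symm⟩

theorem voterCost_le (r : Profile n m) (v : Fin n) {T Q : Finset (Fin m)}
    (hQ : Q ⊆ T) (hs : Q.card = s) : voterCost r s v T ≤ ∑ c ∈ Q, (rank r v c : ℝ) :=
  ciInf_le (f := fun Q : {Q : Finset (Fin m) // Q ⊆ T ∧ Q.card = s} =>
    ∑ c ∈ Q.1, (rank r v c : ℝ)) (Set.finite_range _).bddBelow ⟨Q, hQ, hs⟩

theorem rank_le_rank_of_voterCost_eq {r : Profile n m} {v : Fin n} {T Q : Finset (Fin m)}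
    (hQT : Q ⊆ T) (hQs : Q.card = s) (hQ : voterCost r s v T = ∑ c ∈ Q, (rank r v c : ℝ))
    {c d : Fin m} (hc : c ∈ Q) (hd : d ∈ T \ Q) : rank r v c ≤ rank r v d := by
  rw [Finset.mem_sdiff] at hd
  have hdc : d ∉ Q.erase c := fun h => hd.2 (Finset.mem_of_mem_erase h)
  have hexchange := voterCost_le r (s := s) v (Q := insert d (Q.erase c))
    (Finset.insert_subset hd.1 ((Finset.erase_subset _ _).trans hQT))
    (by rw [Finset.card_insert_of_notMem hdc, Finset.card_erase_add_one hc, hQs])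
  rw [hQ, Finset.sum_insert hdc, ← Finset.add_sum_erase Q _ hc] at hexchange
  exact_mod_cast le_of_add_le_add_right hexchange

theorem voterCost_le_sum_max (r : Profile n m) (v : Fin n) {T : Finset (Fin m)}
    (hs : s ≤ T.card) :
    voterCost r s v T ≤ ∑ t ∈ Finset.range m, max ((s : ℝ) - (topSet r v t ∩ T).card) 0 := by
  obtain ⟨Q, hQT, hQs, hQ⟩ := exists_voterCost_eq r v hs
  rw [hQ, sum_rank_eq_sum_sub_card, hQs]
  refine Finset.sum_le_sum fun t _ => ?_
  by_cases hsub : Q ⊆ topSet r v t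
  · rw [Finset.inter_eq_right.2 hsub, hQs, sub_self]
    exact le_max_right _ _
  · obtain ⟨c, hcQ, hct⟩ := Finset.not_subset.1 hsub
    have hinter : topSet r v t ∩ T ⊆ topSet r v t ∩ Q := by
      refine fun d hd => Finset.mem_inter.2 ⟨(Finset.mem_inter.1 hd).1, by_contra fun hdQ => hct ?_⟩
      rw [Finset.mem_inter] at hd
      exact mem_topSet.2 ((rank_le_rank_of_voterCost_eq hQT hQs hQ hcQ
        (Finset.mem_sdiff.2 ⟨hd.2, hdQ⟩)).trans (mem_topSet.1 hd.1))
    have hcard : ((topSet r v t ∩ T).card : ℝ) ≤ (topSet r v t ∩ Q).card := by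
      exact_mod_cast Finset.card_le_card hinter
    exact le_max_of_le_left (by linarith)

theorem sum_max_le_voter_lp_cost (r : Profile n m) (hs : s ≤ k) {y : Fin m → ℝ}
    {x : Fin n → Fin m → Fin k → ℝ} (hx : LPFeasible k y x) (v : Fin n) :
    ∑ t ∈ Finset.range m, max ((s : ℝ) - ∑ c ∈ topSet r v t, y c) 0 ≤
      ∑ l ∈ Finset.univ.filter (fun l : Fin k => (l : ℕ) < s), ∑ j, x v j l * (rank r v j : ℝ) := by
  set L := Finset.univ.filter (fun l : Fin k => (l : ℕ) < s)
  have hL : L.card = s := by rw [Fin.card_filter_val_lt, min_eq_right hs]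
  have hxy (j : Fin m) : ∑ l ∈ L, x v j l ≤ y j :=
    (Finset.sum_le_sum_of_subset_of_nonneg (Finset.subset_univ L)
      fun l _ _ => (hx.x_mem v j l).1).trans (hx.sum_x_le v j)
  rw [Finset.sum_comm]
  simp only [← Finset.sum_mul]
  rw [sum_mul_rank_eq_sum_sub]
  refine Finset.sum_le_sum fun t _ => max_le ?_ (sub_nonneg.2 ?_)
  · refine sub_le_sub ?_ (Finset.sum_le_sum fun j _ => hxy j)
    rw [Finset.sum_comm]
    simpa [hL] using Finset.card_nsmul_le_sum L _ 1 fun l _ => hx.one_le_sum_x v l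
  · exact Finset.sum_le_sum_of_subset_of_nonneg (Finset.subset_univ _)
      fun j _ _ => Finset.sum_nonneg fun l _ => (hx.x_mem v j l).1

end Cost

section LinearProgram

variable {n m k s : ℕ}

theorem exists_lpFeasible_lpObjective_eq (r : Profile n m) (hs : s ≤ k) {T : Finset (Fin m)}
    (hT : T.card = k) :
    ∃ (y : Fin m → ℝ) (x : Fin n → Fin m → Fin k → ℝ), LPFeasible k y x ∧
      lpObjective r k s x = ∑ v, voterCost r s v T := by
  choose Q hQT hQs hQ using fun v => exists_voterCost_eq r v (T := T) (hT ▸ hs)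
  have hTQ (v : Fin n) : (T \ Q v).card = k - s := by
    rw [Finset.card_sdiff_of_subset (hQT v), hT, hQs]
  have hL : (Finset.univ.filter fun l : Fin k => (l : ℕ) < s).card = s := by
    rw [Fin.card_filter_val_lt, min_eq_right hs]
  have hL' : (Finset.univ.filter fun l : Fin k => ¬(l : ℕ) < s).card = k - s := by
    rw [← Finset.compl_filter, Finset.card_compl, hL, Fintype.card_fin]
  -- The first `s` copies of `v` spread uniformly over the best `s`-subset `Q v` of `T`, the
  -- remaining ones over `T \ Q v`.
  refine ⟨fun j => if j ∈ T then 1 else 0,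
    fun v j l => if (l : ℕ) < s then (if j ∈ Q v then (s : ℝ)⁻¹ else 0)
      else if j ∈ T \ Q v then ((k - s : ℕ) : ℝ)⁻¹ else 0,
    ⟨?_, fun v j => ?_, fun v l => ?_, fun j => ?_, fun v j l => ?_⟩,
    Finset.sum_congr rfl fun v _ => ?_⟩
  · simp [hT]
  · rw [Finset.sum_ite, Finset.sum_const, Finset.sum_const, hL, hL']
    by_cases hjQ : j ∈ Q v
    · simp [hjQ, hQT v hjQ, mul_inv_le_one]
    · by_cases hjT : j ∈ T <;> simp [hjQ, hjT, mul_inv_le_one]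
  · by_cases hl : (l : ℕ) < s
    · have hs₀ : (s : ℝ) ≠ 0 := by exact_mod_cast (by omega : s ≠ 0)
      simp [hl, hQs, hs₀]
    · have hks₀ : ((k - s : ℕ) : ℝ) ≠ 0 := by exact_mod_cast (by omega : k - s ≠ 0)
      simp only [hl, if_false, Finset.sum_ite_mem, Finset.univ_inter, Finset.sum_const, hTQ,
        nsmul_eq_mul, mul_inv_cancel₀ hks₀, le_refl]
  · split_ifs <;> simp
  · split_ifs <;> simp [Nat.cast_inv_le_one]
  · rw [Finset.sum_eq_card_nsmul (b := (s : ℝ)⁻¹ * voterCost r s v T) fun l hl => ?_, hL,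
      nsmul_eq_mul]
    · rcases eq_or_ne s 0 with rfl | hs₀
      · simp [hQ v, Finset.card_eq_zero.1 (hQs v)]
      · exact mul_inv_cancel_left₀ (Nat.cast_ne_zero.2 hs₀) _
    · simp only [(Finset.mem_filter.1 hl).2, if_true, ite_mul, zero_mul, Finset.sum_ite_mem,
        Finset.univ_inter, hQ, Finset.mul_sum]

theorem lpObjective_le_opt (r : Profile n m) (hs : s ≤ k) (hkm : k ≤ m)
    {x : Fin n → Fin m → Fin k → ℝ}
    (hx : ∀ (y' : Fin m → ℝ) (x' : Fin n → Fin m → Fin k → ℝ), LPFeasible k y' x' →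
      lpObjective r k s x ≤ lpObjective r k s x') :
    (1 / (n : ℝ)) * lpObjective r k s x ≤ opt r k s := by
  obtain ⟨T₀, -, hT₀⟩ := Finset.exists_subset_card_eq
    (by simpa using hkm : k ≤ (Finset.univ : Finset (Fin m)).card)
  have : Nonempty {T : Finset (Fin m) // T.card = k} := ⟨⟨T₀, hT₀⟩⟩
  refine le_ciInf fun T => ?_
  obtain ⟨y', x', hfeas, hobj⟩ := exists_lpFeasible_lpObjective_eq r hs T.2
  rw [score, ← hobj]
  exact mul_le_mul_of_nonneg_left (hx y' x' hfeas) (by positivity)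

theorem isCompact_lpFeasible (n m k : ℕ) :
    IsCompact {p : (Fin m → ℝ) × (Fin n → Fin m → Fin k → ℝ) | LPFeasible k p.1 p.2} := by
  have hset : {p : (Fin m → ℝ) × (Fin n → Fin m → Fin k → ℝ) | LPFeasible k p.1 p.2} =
      {p | ∑ j, p.1 j = (k : ℝ)} ∩ {p | ∀ i j, ∑ l, p.2 i j l ≤ p.1 j} ∩
        {p | ∀ i l, 1 ≤ ∑ j, p.2 i j l} ∩ Set.Icc 0 1 := by
    ext p
    constructor
    · intro h
      exact ⟨⟨⟨h.sum_y, h.sum_x_le⟩, h.one_le_sum_x⟩,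
        ⟨fun j => (h.y_mem j).1, fun i j l => (h.x_mem i j l).1⟩,
        ⟨fun j => (h.y_mem j).2, fun i j l => (h.x_mem i j l).2⟩⟩
    · rintro ⟨⟨⟨hy, hxy⟩, hx⟩, h₀, h₁⟩
      exact ⟨hy, hxy, hx, fun j => ⟨h₀.1 j, h₁.1 j⟩, fun i j l => ⟨h₀.2 i j l, h₁.2 i j l⟩⟩
  rw [hset]
  refine isCompact_Icc.inter_left (((isClosed_eq ?_ continuous_const).inter ?_).inter ?_)
  · fun_prop
  · simp only [Set.ofPred_forall]
    exact isClosed_iInter fun i => isClosed_iInter fun j =>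
      isClosed_le (by fun_prop) (by fun_prop)
  · simp only [Set.ofPred_forall]
    exact isClosed_iInter fun i => isClosed_iInter fun l =>
      isClosed_le (by fun_prop) (by fun_prop)

theorem exists_isLPOptimal (r : Profile n m) (hs : s ≤ k) (hkm : k ≤ m) :
    ∃ y, IsLPOptimal r k s y := by
  obtain ⟨T, -, hT⟩ := Finset.exists_subset_card_eq
    (by simpa using hkm : k ≤ (Finset.univ : Finset (Fin m)).card)
  obtain ⟨y₀, x₀, h₀, -⟩ := exists_lpFeasible_lpObjective_eq r hs hT
  have hcont : Continuous fun p : (Fin m → ℝ) × (Fin n → Fin m → Fin k → ℝ) =>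
      lpObjective r k s p.2 := by
    unfold lpObjective
    fun_prop
  obtain ⟨p, hp, hmin⟩ :=
    (isCompact_lpFeasible n m k).exists_isMinOn ⟨(y₀, x₀), h₀⟩ hcont.continuousOn
  exact ⟨p.1, p.2, hp, fun y' x' h' => hmin (a := (y', x')) h'⟩

end LinearProgram

/-! ### Expected shortfall -/

section Shortfall

open Real

variable {X : Type*} [Fintype X] {μ : PMF X} {N : X → ℝ} {a s F P : ℝ}

theorem exp_neg_le_one_sub_add_sq_div_two (ha : 0 ≤ a) : exp (-a) ≤ 1 - a + a ^ 2 / 2 := by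
  have hpos : 0 < 1 + a + a ^ 2 / 2 := by positivity
  calc exp (-a) = (exp a)⁻¹ := exp_neg a
    _ ≤ (1 + a + a ^ 2 / 2)⁻¹ := inv_anti₀ hpos (quadratic_le_exp_of_nonneg ha)
    _ ≤ 1 - a + a ^ 2 / 2 := by
      rw [inv_le_iff_one_le_mul₀ hpos]
      nlinarith [sq_nonneg (a ^ 2)]

theorem mul_one_sub_le_one_sub_exp_neg_mul {q : ℝ} (ha₀ : 0 ≤ a) (ha₁ : a ≤ 1) (hq : q ≤ a / 2) :
    a * (1 - a) ≤ (1 - exp (-a)) * (1 - q) := by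
  have hexp := exp_neg_le_one_sub_add_sq_div_two ha₀
  calc a * (1 - a) ≤ (a - a ^ 2 / 2) * (1 - a / 2) := by nlinarith [pow_nonneg ha₀ 3]
    _ ≤ (1 - exp (-a)) * (1 - q) :=
      mul_le_mul (by linarith) (by linarith) (by linarith) (by nlinarith)

theorem max_zero_le_inv_mul_exp (ha : 0 < a) (x : ℝ) : max x 0 ≤ a⁻¹ * exp (a * x - 1) := by
  refine max_le ?_ (by positivity)
  rw [le_inv_mul_iff₀ ha]
  linarith [add_one_le_exp (a * x - 1)]

theorem mean_max_sub_le_of_mean_exp_le (ha : 0 < a) {M : ℝ}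
    (hN : mean μ (fun T => exp (-(a * N T))) ≤ M) (u : ℝ) :
    mean μ (fun T => max (u - N T) 0) ≤ a⁻¹ * exp (a * u - 1) * M := by
  calc mean μ (fun T => max (u - N T) 0)
      ≤ mean μ (fun T => a⁻¹ * exp (a * u - 1) * exp (-(a * N T))) := by
        refine mean_mono fun T _ => (max_zero_le_inv_mul_exp ha _).trans_eq ?_
        rw [mul_assoc, ← exp_add]
        ring_nf
    _ ≤ a⁻¹ * exp (a * u - 1) * M := by
        rw [mean_const_mul]
        gcongr

theorem mean_shortfall_le_of_le (ha₀ : 0 < a) (ha₁ : a ≤ 1) (has : a ^ 2 * s = 1) (hP : 0 ≤ P)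
    (hN : mean μ (fun T => exp (-(a * N T))) ≤ P * exp (-(a * (1 - a) ^ 2 * F)))
    (hF : (1 - a) * s ≤ F) :
    mean μ (fun T => max (s - N T) 0) ≤ 9 * a⁻¹ * P := by
  have hexponent : a * s - 1 + -(a * (1 - a) ^ 2 * F) ≤ 2 := by
    calc a * s - 1 + -(a * (1 - a) ^ 2 * F)
        ≤ a * s - 1 + -(a * (1 - a) ^ 2 * ((1 - a) * s)) := by gcongr
      _ = 2 - 3 * a + a ^ 2 := by linear_combination (3 - 3 * a + a ^ 2) * has
      _ ≤ 2 := by nlinarith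
  have hexp_two : exp 2 ≤ 9 := by
    calc exp 2 = exp 1 ^ 2 := by rw [← exp_nat_mul]; norm_num
      _ ≤ 3 ^ 2 := pow_le_pow_left₀ (exp_pos 1).le exp_one_lt_three.le 2
      _ = 9 := by norm_num
  calc mean μ (fun T => max (s - N T) 0)
      ≤ a⁻¹ * exp (a * s - 1) * (P * exp (-(a * (1 - a) ^ 2 * F))) :=
        mean_max_sub_le_of_mean_exp_le ha₀ hN s
    _ = exp (a * s - 1 + -(a * (1 - a) ^ 2 * F)) * a⁻¹ * P := by rw [exp_add]; ring
    _ ≤ 9 * a⁻¹ * P := by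
        gcongr
        exact (exp_le_exp.2 hexponent).trans hexp_two

theorem mean_shortfall_le_of_ge (ha₀ : 0 < a) (ha₁ : a ≤ 1) (has : a ^ 2 * s = 1) (hP : P ≤ 1)
    (hN : mean μ (fun T => exp (-(a * N T))) ≤ P * exp (-(a * (1 - a) ^ 2 * F)))
    (hF : F ≤ (1 - a) * s) :
    mean μ (fun T => max (s - N T) 0) ≤ 3 * (s - F) := by
  have hinv : a⁻¹ = a * s := inv_eq_of_mul_eq_one_right (by linarith)
  have hs : 0 < s := by nlinarith
  have hFs : F ≤ s := by nlinarith
  have haF : a * F ≤ a * s := by gcongr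
  have hshift : (1 - a) * F ≤ s := by nlinarith
  have hexponent : a * ((1 - a) * F) - 1 + -(a * (1 - a) ^ 2 * F) ≤ 0 := by
    calc a * ((1 - a) * F) - 1 + -(a * (1 - a) ^ 2 * F) = a * (1 - a) * (a * F) - 1 := by ring
      _ ≤ a * (1 - a) * (a * s) - 1 := by
          have := sub_nonneg.2 ha₁
          gcongr
      _ ≤ 0 := by nlinarith
  have hscaled : mean μ (fun T => max ((1 - a) * F - N T) 0) ≤ a⁻¹ := by
    calc mean μ (fun T => max ((1 - a) * F - N T) 0)
        ≤ a⁻¹ * exp (a * ((1 - a) * F) - 1) * (P * exp (-(a * (1 - a) ^ 2 * F))) :=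
          mean_max_sub_le_of_mean_exp_le ha₀ hN _
      _ = a⁻¹ * (P * exp (a * ((1 - a) * F) - 1 + -(a * (1 - a) ^ 2 * F))) := by
          rw [exp_add]; ring
      _ ≤ a⁻¹ * (1 * 1) := by
          gcongr
          exact exp_le_one_iff.2 hexponent
      _ = a⁻¹ := by ring
  calc mean μ (fun T => max (s - N T) 0)
      ≤ mean μ (fun T => (s - (1 - a) * F) + max ((1 - a) * F - N T) 0) :=
        mean_mono fun T _ => max_le (by linarith [le_max_left ((1 - a) * F - N T) 0])
          (by linarith [le_max_right ((1 - a) * F - N T) 0])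
    _ ≤ (s - (1 - a) * F) + a⁻¹ := by
        rw [mean_add, mean_const]
        gcongr
    _ ≤ 3 * (s - F) := by linarith

theorem mean_shortfall_le (ha₀ : 0 < a) (ha₁ : a ≤ 1) (has : a ^ 2 * s = 1)
    (hP : P ∈ Set.Icc (0 : ℝ) 1)
    (hN : mean μ (fun T => exp (-(a * N T))) ≤ P * exp (-(a * (1 - a) ^ 2 * F))) :
    mean μ (fun T => max (s - N T) 0) ≤ 3 * max (s - F) 0 + 9 * a⁻¹ * P := by
  have hterm : 0 ≤ 9 * a⁻¹ * P := mul_nonneg (by positivity) hP.1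
  rcases le_total ((1 - a) * s) F with hF | hF
  · linarith [mean_shortfall_le_of_le ha₀ ha₁ has hP.1 hN hF, le_max_right (s - F) 0]
  · linarith [mean_shortfall_le_of_ge ha₀ ha₁ has hP.2 hN hF, le_max_left (s - F) 0]

theorem sum_pow_one_sub_le {x : ℝ} (hx₀ : 0 < x) (hx₁ : x ≤ 1) (m : ℕ) :
    ∑ t ∈ Finset.range m, (1 - x) ^ t ≤ x⁻¹ := by
  have hgeom := mul_neg_geom_sum (1 - x) m
  rw [sub_sub_cancel] at hgeom
  rw [← one_div, le_div_iff₀' hx₀, hgeom]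
  linarith [pow_nonneg (sub_nonneg.2 hx₁) m]

end Shortfall

/-! ### The algorithm -/

section Algorithm

open Real

variable {n m k s : ℕ} {a : ℝ} {y : Fin m → ℝ} {ν : PMF (Finset (Fin m))}

theorem one_sub_mul_mem_Icc {C : Type*} {y : C → ℝ} (ha : a ∈ Set.Icc (0 : ℝ) 1)
    (hy : ∀ c, y c ∈ Set.Icc (0 : ℝ) 1) (c : C) : (1 - a) * y c ∈ Set.Icc (0 : ℝ) 1 :=
  ⟨mul_nonneg (sub_nonneg.2 ha.2) (hy c).1,
    mul_le_one₀ (sub_le_self 1 ha.1) (hy c).1 (hy c).2⟩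

theorem card_add_floor_le_of_scaled {C : Type*} [Fintype C] [DecidableEq C] {y : C → ℝ}
    {ν : PMF (Finset C)} (ha : 0 ≤ a) (hy : ∑ c, y c = k)
    (hν : DependentRounding (fun c => (1 - a) * y c) ν) {T : Finset C}
    (hT : T ∈ ν.support) : T.card + ⌊a * k⌋₊ ≤ k :=
  hν.card_add_floor_le (by positivity) (by rw [← Finset.mul_sum, hy]; ring) hT

theorem card_of_mem_support_scaled_bind (ha : 0 ≤ a) (hkm : k ≤ m) (hy : ∑ c, y c = k)
    (hν : DependentRounding (fun c => (1 - a) * y c) ν) {T : Finset (Fin m)}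
    (hT : T ∈ (ν.bind (completeUniformly hkm)).support) : T.card = k := by
  obtain ⟨T₁, hT₁, hT⟩ := (PMF.mem_support_bind_iff _ _ _).1 hT
  exact card_of_mem_support_completeUniformly hkm
    ((Nat.le_add_right _ _).trans (card_add_floor_le_of_scaled ha hy hν hT₁)) hT

theorem completion_rate_le (ha : 0 ≤ a) (hkm : k ≤ m) : a * k / (2 * m) ≤ a / 2 := by
  have hratio : (k : ℝ) / m ≤ 1 := div_le_one_of_le₀ (by exact_mod_cast hkm) (Nat.cast_nonneg m)
  calc a * k / (2 * m) = a / 2 * (k / m) := by ring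
    _ ≤ a / 2 := mul_le_of_le_one_right (by positivity) hratio

theorem avoidanceLE_scaled_bind (ha : a ∈ Set.Icc (0 : ℝ) 1) (hkm : k ≤ m) (hak : 1 ≤ a * k)
    (hsum : ∑ c, y c = k) (hy : ∀ c, y c ∈ Set.Icc (0 : ℝ) 1)
    (hν : DependentRounding (fun c => (1 - a) * y c) ν) :
    AvoidanceLE (ν.bind (completeUniformly hkm))
      fun c => (1 - a * k / (2 * m)) * (1 - (1 - a) * y c) :=
  (hν.avoidanceLE (one_sub_mul_mem_Icc ha hy)).bind_completeUniformly hkm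
    (by linarith [completion_rate_le ha.1 hkm, ha.2])
    fun _ hT₁ => div_two_mul_le_completion_rate hak hkm
      (card_add_floor_le_of_scaled ha.1 hsum hν hT₁)

theorem completion_decay_mem_Icc (ha₀ : 0 ≤ a) (ha₁ : a ≤ 1) (hkm : k ≤ m) :
    (1 - exp (-a)) * (a * k / (2 * m)) ∈ Set.Icc (0 : ℝ) 1 := by
  have hb : 0 ≤ 1 - exp (-a) := sub_nonneg.2 (exp_le_one_iff.2 (neg_nonpos.2 ha₀))
  exact ⟨by positivity, mul_le_one₀ (sub_le_self 1 (exp_pos _).le) (by positivity)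
    (by linarith [completion_rate_le ha₀ hkm])⟩

theorem mean_exp_neg_card_topSet_le (r : Profile n m) (v : Fin n) (ha : a ∈ Set.Icc (0 : ℝ) 1)
    (hkm : k ≤ m) (hak : 1 ≤ a * k) (hsum : ∑ c, y c = k) (hy : ∀ c, y c ∈ Set.Icc (0 : ℝ) 1)
    (hν : DependentRounding (fun c => (1 - a) * y c) ν) {t : ℕ} (ht : t ≤ m) :
    mean (ν.bind (completeUniformly hkm)) (fun T => exp (-(a * (topSet r v t ∩ T).card))) ≤
      (1 - (1 - exp (-a)) * (a * k / (2 * m))) ^ t *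
        exp (-(a * (1 - a) ^ 2 * ∑ c ∈ topSet r v t, y c)) := by
  have ha₀ := ha.1
  have hq := completion_rate_le ha₀ hkm
  have hq₀ : 0 ≤ a * k / (2 * m) := by positivity
  have hmoment := (avoidanceLE_scaled_bind ha hkm hak hsum hy hν).mean_exp_neg_card_le
    (one_sub_mul_mem_Icc ha hy) ⟨hq₀, by linarith [ha.2]⟩ ha₀ (topSet r v t)
  rw [card_topSet r v ht, ← Finset.mul_sum] at hmoment
  have hF : 0 ≤ (1 - a) * ∑ c ∈ topSet r v t, y c :=
    mul_nonneg (sub_nonneg.2 ha.2) (Finset.sum_nonneg fun c _ => (hy c).1)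
  have hbase : 0 ≤ 1 - (1 - exp (-a)) * (a * k / (2 * m)) :=
    sub_nonneg.2 (completion_decay_mem_Icc ha₀ ha.2 hkm).2
  refine hmoment.trans
    (mul_le_mul_of_nonneg_left (exp_le_exp.2 (neg_le_neg ?_)) (pow_nonneg hbase t))
  calc a * (1 - a) ^ 2 * ∑ c ∈ topSet r v t, y c
      = a * (1 - a) * ((1 - a) * ∑ c ∈ topSet r v t, y c) := by ring
    _ ≤ _ := mul_le_mul_of_nonneg_right (mul_one_sub_le_one_sub_exp_neg_mul ha₀ ha.2 hq) hF

theorem sum_pow_completion_le (ha₀ : 0 < a) (ha₁ : a ≤ 1) (hk : 0 < k) (hkm : k ≤ m) :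
    ∑ t ∈ Finset.range m, (1 - (1 - exp (-a)) * (a * k / (2 * m))) ^ t ≤
      4 * (a⁻¹ ^ 2) * (m / k) := by
  have : (0 : ℝ) < k := by exact_mod_cast hk
  have : (0 : ℝ) < m := by exact_mod_cast hk.trans_le hkm
  have hb : a / 2 ≤ 1 - exp (-a) := by
    nlinarith [exp_neg_le_one_sub_add_sq_div_two ha₀.le]
  calc _ ≤ ((1 - exp (-a)) * (a * k / (2 * m)))⁻¹ :=
        sum_pow_one_sub_le (mul_pos (by linarith) (by positivity))
          (completion_decay_mem_Icc ha₀.le ha₁ hkm).2 m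
    _ ≤ (a / 2 * (a * k / (2 * m)))⁻¹ := by gcongr
    _ = 4 * (a⁻¹ ^ 2) * (m / k) := by field_simp; norm_num

theorem mean_voterCost_le (r : Profile n m) (v : Fin n) {x : Fin n → Fin m → Fin k → ℝ}
    (ha₀ : 0 < a) (ha₁ : a ≤ 1) (has : a ^ 2 * s = 1) (hak : 1 ≤ a * k) (hsk : s ≤ k)
    (hkm : k ≤ m) (hx : LPFeasible k y x) (hν : DependentRounding (fun c => (1 - a) * y c) ν) :
    mean (ν.bind (completeUniformly hkm)) (voterCost r s v) ≤
      3 * ∑ l ∈ Finset.univ.filter (fun l : Fin k => (l : ℕ) < s),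
        ∑ j, x v j l * (rank r v j : ℝ) + 36 * a⁻¹ ^ 3 * (m / k) := by
  have hk : 0 < k := Nat.cast_pos.1 (pos_of_mul_pos_right (one_pos.trans_le hak) ha₀.le)
  set d : ℝ := (1 - exp (-a)) * (a * k / (2 * m))
  have hd : d ∈ Set.Icc (0 : ℝ) 1 := completion_decay_mem_Icc ha₀.le ha₁ hkm
  have hcost : ∀ T ∈ (ν.bind (completeUniformly hkm)).support, voterCost r s v T ≤
      ∑ t ∈ Finset.range m, max ((s : ℝ) - (topSet r v t ∩ T).card) 0 := fun T hT =>
    voterCost_le_sum_max r v (hsk.trans_eq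
      (card_of_mem_support_scaled_bind ha₀.le hkm hx.sum_y hν hT).symm)
  have hlayer : ∀ t ∈ Finset.range m, mean (ν.bind (completeUniformly hkm))
      (fun T => max ((s : ℝ) - (topSet r v t ∩ T).card) 0) ≤
        3 * max ((s : ℝ) - ∑ c ∈ topSet r v t, y c) 0 + 9 * a⁻¹ * (1 - d) ^ t := fun t ht =>
    mean_shortfall_le ha₀ ha₁ has
      ⟨pow_nonneg (sub_nonneg.2 hd.2) t, pow_le_one₀ (sub_nonneg.2 hd.2) (sub_le_self 1 hd.1)⟩
      (mean_exp_neg_card_topSet_le r v ⟨ha₀.le, ha₁⟩ hkm hak hx.sum_y hx.y_mem hν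
        (Finset.mem_range.1 ht).le)
  calc mean (ν.bind (completeUniformly hkm)) (voterCost r s v)
      ≤ ∑ t ∈ Finset.range m, mean (ν.bind (completeUniformly hkm))
          (fun T => max ((s : ℝ) - (topSet r v t ∩ T).card) 0) :=
        (mean_mono hcost).trans_eq (mean_sum _ _ _)
    _ ≤ 3 * ∑ t ∈ Finset.range m, max ((s : ℝ) - ∑ c ∈ topSet r v t, y c) 0 +
          9 * a⁻¹ * ∑ t ∈ Finset.range m, (1 - d) ^ t := by
        rw [Finset.mul_sum, Finset.mul_sum, ← Finset.sum_add_distrib]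
        exact Finset.sum_le_sum hlayer
    _ ≤ 3 * ∑ l ∈ Finset.univ.filter (fun l : Fin k => (l : ℕ) < s),
          ∑ j, x v j l * (rank r v j : ℝ) + 9 * a⁻¹ * (4 * a⁻¹ ^ 2 * (m / k)) := by
        gcongr
        · exact sum_max_le_voter_lp_cost r hsk hx v
        · exact sum_pow_completion_le ha₀ ha₁ hk hkm
    _ = _ := by ring

theorem expectedScore_eq_sum_mean (r : Profile n m) (s : ℕ) (μ : PMF (Finset (Fin m))) :
    expectedScore r s μ = 1 / (n : ℝ) * ∑ v, mean μ (voterCost r s v) := by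
  rw [← mean_sum, ← mean_const_mul]
  rfl

theorem one_div_sqrt_mem_Ioc (hs : 1 ≤ s) : 1 / √(s : ℝ) ∈ Set.Ioc (0 : ℝ) 1 := by
  have hsqrt : 1 ≤ √(s : ℝ) := one_le_sqrt.2 (by exact_mod_cast hs)
  exact ⟨by positivity, div_le_one_of_le₀ hsqrt (by positivity)⟩

theorem expectedScore_le (r : Profile n m) {μ : PMF (Finset (Fin m))} (hs : 1 ≤ s) (hsk : s ≤ k)
    (hkm : k ≤ m) (hμ : IsOutputLaw r s hkm μ) :
    expectedScore r s μ ≤ 3 * opt r k s + 36 * √(s : ℝ) ^ 3 * (m / k) := by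
  obtain ⟨y, ν, ⟨x, hx, hopt⟩, hν, rfl⟩ := hμ
  obtain ⟨ha₀, ha₁⟩ := one_div_sqrt_mem_Ioc hs
  have hs₀ : (0 : ℝ) < s := by exact_mod_cast hs
  have has : (1 / √(s : ℝ)) ^ 2 * s = 1 := by
    rw [div_pow, sq_sqrt hs₀.le, one_pow, one_div_mul_cancel hs₀.ne']
  have hak : 1 ≤ 1 / √(s : ℝ) * k := by
    have hsk' : (s : ℝ) ≤ k := by exact_mod_cast hsk
    nlinarith
  have hvoter (v : Fin n) := mean_voterCost_le r v ha₀ ha₁ has hak hsk hkm hx hν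
  rw [inv_div, div_one] at hvoter
  have hmass : 1 / (n : ℝ) * n ≤ 1 := by
    rw [one_div_mul_eq_div]
    exact div_self_le_one _
  calc expectedScore r s (ν.bind (completeUniformly hkm))
      ≤ 1 / (n : ℝ) * (3 * lpObjective r k s x + n * (36 * √(s : ℝ) ^ 3 * (m / k))) := by
        rw [expectedScore_eq_sum_mean]
        gcongr
        refine (Finset.sum_le_sum fun v _ => hvoter v).trans_eq ?_
        simp [lpObjective, Finset.sum_add_distrib, Finset.mul_sum]
    _ = 3 * (1 / (n : ℝ) * lpObjective r k s x) +
          1 / (n : ℝ) * n * (36 * √(s : ℝ) ^ 3 * (m / k)) := by ring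
    _ ≤ 3 * opt r k s + 36 * √(s : ℝ) ^ 3 * (m / k) := by
        exact add_le_add
          (mul_le_mul_of_nonneg_left (lpObjective_le_opt r hsk hkm hopt) (by norm_num))
          (mul_le_of_le_one_left (by positivity) hmass)

theorem card_of_mem_support_isOutputLaw {r : Profile n m} {hkm : k ≤ m}
    {μ : PMF (Finset (Fin m))} (hμ : IsOutputLaw r s hkm μ) {T : Finset (Fin m)}
    (hT : T ∈ μ.support) : T.card = k := by
  obtain ⟨y, ν, ⟨x, hx, -⟩, hν, rfl⟩ := hμ
  exact card_of_mem_support_scaled_bind (by positivity) hkm hx.sum_y hν hT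

theorem exists_isOutputLaw (r : Profile n m) (hs : 1 ≤ s) (hsk : s ≤ k) (hkm : k ≤ m) :
    ∃ μ, IsOutputLaw r s hkm μ := by
  obtain ⟨y, hy⟩ := exists_isLPOptimal r hsk hkm
  obtain ⟨x, hx, -⟩ := id hy
  obtain ⟨ν, hν⟩ := exists_dependentRounding _
    (one_sub_mul_mem_Icc (Set.Ioc_subset_Icc_self (one_div_sqrt_mem_Ioc hs)) hx.y_mem)
  exact ⟨_, y, ν, hy, hν, rfl⟩

theorem div_le_two_mul_add_one_div_add_one (m : ℕ) (hk : 1 ≤ k) :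
    (m : ℝ) / k ≤ 2 * ((m + 1) / (k + 1)) := by
  have hk' : (1 : ℝ) ≤ k := by exact_mod_cast hk
  rw [← mul_div_assoc, div_le_div_iff₀ (by linarith) (by linarith)]
  nlinarith [Nat.cast_nonneg (α := ℝ) m]

end Algorithm

end SBorda

theorem mainTheorem5_general {n m k s : ℕ} (r : SBorda.Profile n m) (hs : 1 ≤ s) (hsk : s ≤ k)
    (hkm : k ≤ m) :
    (∃ μ : PMF (Finset (Fin m)), SBorda.IsOutputLaw r s hkm μ) ∧
    ∀ μ : PMF (Finset (Fin m)), SBorda.IsOutputLaw r s hkm μ →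
      (∀ T ∈ μ.support, T.card = k) ∧
      SBorda.expectedScore r s μ ≤
        3 * SBorda.opt r k s + 72 * (s : ℝ) ^ (3 / 2 : ℝ) * (((m : ℝ) + 1) / ((k : ℝ) + 1)) := by
  refine ⟨SBorda.exists_isOutputLaw r hs hsk hkm, fun μ hμ =>
    ⟨fun T hT => SBorda.card_of_mem_support_isOutputLaw hμ hT, ?_⟩⟩
  calc SBorda.expectedScore r s μ
      ≤ 3 * SBorda.opt r k s + 36 * √(s : ℝ) ^ 3 * (m / k) :=
        SBorda.expectedScore_le r hs hsk hkm hμ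
    _ ≤ 3 * SBorda.opt r k s + 36 * √(s : ℝ) ^ 3 * (2 * (((m : ℝ) + 1) / ((k : ℝ) + 1))) := by
        gcongr
        exact SBorda.div_le_two_mul_add_one_div_add_one m (hs.trans hsk)
    _ = _ := by
        rw [Real.rpow_div_two_eq_sqrt _ (Nat.cast_nonneg s), ← Real.rpow_natCast]
        push_cast
        ring

/-- Asymptotic hypotheses are read with absolute constants: there is `N` such that the bound holds
whenever `s ≥ N`, `k ≥ N s^{3/2}` and `m ≥ N k`, and the constant `A` in the `O(·)` is absolute. -/
theorem mainTheorem5 :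
    ∃ A N : ℝ, 0 < A ∧ 0 < N ∧
      ∀ (n m k s : ℕ) (r : SBorda.Profile n m) (hkm : k ≤ m),
        N ≤ (s : ℝ) → N * (s : ℝ) ^ (3 / 2 : ℝ) ≤ (k : ℝ) → N * (k : ℝ) ≤ (m : ℝ) →
        (∃ μ : PMF (Finset (Fin m)), SBorda.IsOutputLaw r s hkm μ) ∧
        ∀ μ : PMF (Finset (Fin m)), SBorda.IsOutputLaw r s hkm μ →
          (∀ T ∈ μ.support, T.card = k) ∧
          SBorda.expectedScore r s μ ≤
            3 * SBorda.opt r k s +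
              A * ((s : ℝ) ^ (3 / 2 : ℝ) * Real.log s) * (((m : ℝ) + 1) / ((k : ℝ) + 1)) := by
  refine ⟨72, 3, by norm_num, by norm_num, fun n m k s r hkm hs hk _ => ?_⟩
  have hs₁ : (1 : ℝ) ≤ s := by linarith
  have hsk : (s : ℝ) ≤ k := by
    linarith [Real.self_le_rpow_of_one_le hs₁ (by norm_num : (1 : ℝ) ≤ 3 / 2)]
  have hlog : 1 ≤ Real.log s :=
    (Real.le_log_iff_exp_le (by linarith)).2 (Real.exp_one_lt_three.le.trans hs)
  obtain ⟨hexists, hbound⟩ :=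
    mainTheorem5_general r (by exact_mod_cast hs₁) (by exact_mod_cast hsk) hkm
  refine ⟨hexists, fun μ hμ => ⟨(hbound μ hμ).1, (hbound μ hμ).2.trans ?_⟩⟩
  gcongr
  exact le_mul_of_one_le_right (by positivity) hlog
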